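/- Let $m\ge 0$, $n\ge 1$ and $k\ge 1$ be integers, and let $f_1,\dots,f_n:\mathbb{R}^m\to\mathbb{R}^m$ be affine maps satisfying the Open Set Condition: there is a non-empty open set $U\subseteq\mathbb{R}^m$ with $\bigcup_{i=1}^n f_i(U)\subseteq U$ and $f_i(U)\cap f_j(U)=\emptyset$ for all $i\ne j$. Call a map $g:\mathbb{R}^m\to\mathbb{R}^m$ a similarity contraction with ratio $c$ if $0<c<1$ and $\|g(x)-g(y)\|=c\,\|x-y\|$ for all $x,y\in\mathbb{R}^m$ (Euclidean norm). Suppose that every composition $f_{j_1}\circ\cdots\circ f_{j_k}$ of length $k$, with $j_1,\dots,j_k\in\{1,\dots,n\}$, is a similarity contraction (with a ratio that may depend on $(j_1,\dots,j_k)$), and let $c_i$ be a ratio of the $k$-fold composition $f_i^k=f_i\circ\cdots\circ f_i$ (it is uniquely determined when $m\ge 1$). Then there exists a unique non-empty compact set $A\subseteq\mathbb{R}^m$ (the attractor) satisfying $A=\bigcup_{i=1}^n f_i(A)$. Moreover, the Hausdorff dimension $s=\dim_H(A)$ is finite, and it is the unique real number satisfying $$\sum_{i=1}^n c_i^{s/k}=1.$$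 -/

import Mathlib

open scoped ENNReal

/-- `g` is a similarity contraction with ratio `c`: `0 < c < 1` and `‖g x - g y‖ = c ‖x - y‖`
for all `x, y`. -/
def IsSimilarityContractionWith {m : ℕ} (c : ℝ)
    (g : EuclideanSpace ℝ (Fin m) → EuclideanSpace ℝ (Fin m)) : Prop :=
  0 < c ∧ c < 1 ∧ ∀ x y, ‖g x - g y‖ = c * ‖x - y‖

/-- `g` is a similarity contraction (for some ratio in `(0, 1)`). -/
def IsSimilarityContraction {m : ℕ}
    (g : EuclideanSpace ℝ (Fin m) → EuclideanSpace ℝ (Fin m)) : Prop :=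
  ∃ c : ℝ, IsSimilarityContractionWith c g

/-- The composition `f i₁ ∘ f i₂ ∘ ⋯ ∘ f iₖ` along the word `[i₁, i₂, …, iₖ]`. -/
def wordComp {ι X : Type*} (f : ι → X → X) : List ι → X → X
  | [] => id
  | i :: w => f i ∘ wordComp f w

/-- The open set condition: there is a non-empty open set `U` with `⋃ i, f i (U) ⊆ U` whose images
`f i (U)` are pairwise disjoint. -/
def OpenSetCondition {ι X : Type*} [TopologicalSpace X] (f : ι → X → X) : Prop :=
  ∃ U : Set X, U.Nonempty ∧ IsOpen U ∧ (⋃ i, f i '' U) ⊆ U ∧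
    ∀ i j, i ≠ j → f i '' U ∩ f j '' U = ∅

/-- `A` is an attractor of the system `f`: a non-empty compact set with `A = ⋃ i, f i (A)`. -/
def IsAttractor {ι X : Type*} [TopologicalSpace X] (f : ι → X → X) (A : Set X) : Prop :=
  A.Nonempty ∧ IsCompact A ∧ A = ⋃ i, f i '' A

/-!
The maps `f i` need not be contractions, but the compositions `g v` along words `v` of a fixed
length `k` are contracting similarities, and the system `g` inherits the attractor and the open set
condition from `f`.

**Attractor.** The `k`-th iterate of the Hutchinson operator of `f` is the Hutchinson operator of
`g`, hence a contraction of the complete space of non-empty compact sets with the Hausdorff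
distance. A map with a contracting iterate has exactly one fixed point
(`exists_unique_isAttractor`).

**Dimension.** For similarities with ratios `r` satisfying the open set condition, `dimH A = s`
where `∑ r i ^ s = 1` (`dimH_attractor`). The bound from above comes from covering `A` by its pieces
of level `N` (`hausdorffMeasure_attractor_le`). For the bound from below, the Bernoulli measure with
weights `r i ^ s` on sequences is pushed forward to `A` along the coding map. A ball of radius `ρ`
meets only boundedly many of the pieces that belong to the shortest words of weight at most `ρ`
(`exists_ncard_le`), so it has measure at most `C ρ ^ s`, and the mass distribution principle
(`le_smul_hausdorffMeasure_of_closedBall_le`) gives positive `s`-dimensional Hausdorff measure.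
The open set of the condition may be unbounded: only a ball inside it and the compactness of `A`
are used.

**Ratios.** The absolute value of the determinant of a similarity of `ℝ^m` is the `m`-th power of
its ratio, and determinants are multiplicative. So for `m ≥ 1` the ratio of `g v` is
`∏ j, c (v j) ^ (1 / k)`, where `c i` is the ratio of `f i^[k]`
(`isSimilarityContractionWith_wordWeight`). Therefore the dimension equation of `g` is the `k`-th
power of the equation `∑ i, c i ^ (s / k) = 1`, whose solution is unique because its left-hand side
is strictly decreasing in `s` (`exists_unique_sum_rpow_eq_one`).
-/

open Set Function Filter Topology MeasureTheory
open scoped NNReal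

/-! ### Words -/

section Words

variable {ι X : Type*} {f : ι → X → X} {U : Set X}

theorem wordComp_append (f : ι → X → X) (u v : List ι) :
    wordComp f (u ++ v) = wordComp f u ∘ wordComp f v := by
  induction u with
  | nil => rfl
  | cons i u ih => simp only [List.cons_append, wordComp, ih, comp_assoc]

theorem wordComp_replicate (f : ι → X → X) (i : ι) (k : ℕ) :
    wordComp f (List.replicate k i) = (f i)^[k] := by
  induction k with
  | zero => rfl
  | succ k ih => rw [List.replicate_succ, wordComp, ih, iterate_succ']

theorem wordComp_induction {p : (X → X) → Prop} (hid : p id)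
    (hcomp : ∀ g h, p g → p h → p (g ∘ h)) (hf : ∀ i, p (f i)) (w : List ι) :
    p (wordComp f w) := by
  induction w with
  | nil => exact hid
  | cons i w ih => exact hcomp _ _ (hf i) ih

theorem wordComp_image_subset (hU : (⋃ i, f i '' U) ⊆ U) (w : List ι) :
    wordComp f w '' U ⊆ U := by
  refine wordComp_induction (p := fun g => g '' U ⊆ U) (by simp) (fun g h hg hh => ?_)
    (fun i => (subset_iUnion (fun i => f i '' U) i).trans hU) w
  rw [image_comp]
  exact (image_mono hh).trans hg

theorem disjoint_wordComp_image (hinj : ∀ i, Injective (f i)) (hU : (⋃ i, f i '' U) ⊆ U)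
    (hdisj : ∀ i j, i ≠ j → f i '' U ∩ f j '' U = ∅) {u v : List ι}
    (huv : ¬ u <+: v) (hvu : ¬ v <+: u) :
    Disjoint (wordComp f u '' U) (wordComp f v '' U) := by
  induction u generalizing v with
  | nil => exact absurd List.nil_prefix huv
  | cons i u ih =>
    cases v with
    | nil => exact absurd List.nil_prefix hvu
    | cons j v =>
      simp only [wordComp, image_comp]
      by_cases hij : i = j
      · subst hij
        rw [disjoint_image_iff (hinj i)]
        exact ih (fun h => huv (List.cons_prefix_cons.2 ⟨rfl, h⟩))
          (fun h => hvu (List.cons_prefix_cons.2 ⟨rfl, h⟩))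
      · exact (disjoint_iff_inter_eq_empty.2 (hdisj i j hij)).mono
          (image_mono (wordComp_image_subset hU u)) (image_mono (wordComp_image_subset hU v))

/-- The Hutchinson operator `S ↦ ⋃ i, f i (S)` of the system `f`, on arbitrary sets. -/
def hutchinson (f : ι → X → X) (S : Set X) : Set X := ⋃ i, f i '' S

theorem hutchinson_iterate (f : ι → X → X) (N : ℕ) (S : Set X) :
    (hutchinson f)^[N] S = ⋃ v : Fin N → ι, wordComp f (List.ofFn v) '' S := by
  induction N with
  | zero => simp [wordComp, iUnion_const]
  | succ N ih =>
    rw [iterate_succ_apply', ih, hutchinson]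
    ext x
    simp only [mem_iUnion, image_iUnion]
    constructor
    · rintro ⟨i, v, hx⟩
      refine ⟨Fin.cons i v, ?_⟩
      rw [List.ofFn_succ]
      simpa only [Fin.cons_zero, Fin.cons_succ, wordComp, image_comp] using hx
    · rintro ⟨v, hx⟩
      refine ⟨v 0, fun j => v j.succ, ?_⟩
      rw [List.ofFn_succ] at hx
      simpa only [wordComp, image_comp] using hx

theorem eq_iUnion_wordComp {A : Set X} (hA : A = ⋃ i, f i '' A) (N : ℕ) :
    A = ⋃ v : Fin N → ι, wordComp f (List.ofFn v) '' A := by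
  rw [← hutchinson_iterate]
  exact (iterate_fixed (f := hutchinson f) hA.symm N).symm

end Words

/-! ### Existence and uniqueness of the attractor -/

section Attractor

open TopologicalSpace

variable {ι X : Type*} [Finite ι] [Nonempty ι]

/-- The Hutchinson operator of a finite system of continuous maps, acting on the non-empty compact
sets. -/
def hutchinsonMap [TopologicalSpace X] (f : ι → X → X) (hf : ∀ i, Continuous (f i))
    (K : NonemptyCompacts X) : NonemptyCompacts X where
  carrier := hutchinson f K
  isCompact' := isCompact_iUnion fun i => K.isCompact.image (hf i)
  nonempty' := nonempty_iUnion.2 ⟨Classical.arbitrary ι, K.nonempty.image _⟩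

theorem coe_hutchinsonMap_iterate [TopologicalSpace X] (f : ι → X → X)
    (hf : ∀ i, Continuous (f i)) (N : ℕ) (K : NonemptyCompacts X) :
    ((hutchinsonMap f hf)^[N] K : Set X) = (hutchinson f)^[N] K :=
  Semiconj.iterate_right (f := fun K : NonemptyCompacts X => (K : Set X))
    (ga := hutchinsonMap f hf) (gb := hutchinson f) (fun _ => rfl) N K

theorem hausdorffEDist_image_le_of_lipschitzWith [PseudoEMetricSpace X] {K : ℝ≥0} {g : X → X}
    (hg : LipschitzWith K g) {S T : Set X} (hS : S.Nonempty) (hT : T.Nonempty) :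
    Metric.hausdorffEDist (g '' S) (g '' T) ≤ K * Metric.hausdorffEDist S T := by
  have key : ∀ S T : Set X, T.Nonempty → ∀ x ∈ g '' S,
      Metric.infEDist x (g '' T) ≤ K * Metric.hausdorffEDist S T := by
    rintro S T hT _ ⟨x, hx, rfl⟩
    have := hT.to_subtype
    calc Metric.infEDist (g x) (g '' T) ≤ K * Metric.infEDist x T := by
          simp only [Metric.infEDist, iInf_image, iInf_subtype']
          rw [ENNReal.mul_iInf' (fun h => absurd h ENNReal.coe_ne_top) (fun _ => inferInstance)]
          exact iInf_mono fun y => hg x y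
      _ ≤ K * Metric.hausdorffEDist S T := by
          gcongr
          exact Metric.infEDist_le_hausdorffEDist_of_mem hx
  exact Metric.hausdorffEDist_le_of_infEDist (key S T hT)
    (fun x hx => Metric.hausdorffEDist_comm (s := S) ▸ key T S hS x hx)

/-- If all compositions of some fixed length are uniform contractions, then so is an iterate of the
Hutchinson operator, for the Hausdorff distance; this suffices for a unique fixed point. -/
theorem exists_unique_isAttractor [MetricSpace X] [CompleteSpace X] [Nonempty X] {f : ι → X → X}
    (hf : ∀ i, Continuous (f i)) {N : ℕ} {K : ℝ≥0} (hK : K < 1)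
    (hfN : ∀ v : Fin N → ι, LipschitzWith K (wordComp f (List.ofFn v))) :
    ∃ A, IsAttractor f A ∧ ∀ B, IsAttractor f B → B = A := by
  have hcontr : ContractingWith K (hutchinsonMap f hf)^[N] := by
    refine ⟨hK, fun S T => ?_⟩
    change Metric.hausdorffEDist (_ : Set X) _ ≤ K * Metric.hausdorffEDist (S : Set X) T
    rw [coe_hutchinsonMap_iterate, coe_hutchinsonMap_iterate, hutchinson_iterate,
      hutchinson_iterate]
    exact Metric.hausdorffEDist_iUnion_le.trans
      (iSup_le fun v => hausdorffEDist_image_le_of_lipschitzWith (hfN v) S.nonempty T.nonempty)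
  have hfix := hcontr.isFixedPt_fixedPoint_iterate
  refine ⟨(hcontr.fixedPoint _ : Set X), ⟨NonemptyCompacts.nonempty _,
    NonemptyCompacts.isCompact _, (congrArg SetLike.coe hfix).symm⟩, ?_⟩
  rintro B ⟨hne, hcomp, hB⟩
  let B' : NonemptyCompacts X := ⟨⟨B, hcomp⟩, hne⟩
  have hB' : IsFixedPt (hutchinsonMap f hf) B' := NonemptyCompacts.ext hB.symm
  exact congrArg SetLike.coe (hcontr.fixedPoint_unique (hB'.iterate N))

end Attractor

/-! ### Systems of similarities: weights of words and the upper bound -/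

section Similarities

variable {ι X : Type*} [MetricSpace X] {g : ι → X → X} {r : ι → ℝ≥0}

/-- The weight of a word: the product of the ratios of its letters. -/
def wordWeight {ι : Type*} (r : ι → ℝ≥0) (w : List ι) : ℝ≥0 := (w.map r).prod

theorem wordWeight_append (u v : List ι) :
    wordWeight r (u ++ v) = wordWeight r u * wordWeight r v := by
  simp [wordWeight]

theorem wordWeight_ofFn {N : ℕ} (v : Fin N → ι) :
    wordWeight r (List.ofFn v) = ∏ j, r (v j) := by
  simp [wordWeight, List.map_ofFn, List.prod_ofFn]

theorem wordWeight_le_pow {K : ℝ≥0} (hK : ∀ i, r i ≤ K) (w : List ι) :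
    wordWeight r w ≤ K ^ w.length := by
  simpa [wordWeight] using List.prod_le_pow_card (w.map r) K (by simpa using fun i _ => hK i)

theorem wordWeight_pos (hr : ∀ i, 0 < r i) (w : List ι) : 0 < wordWeight r w := by
  rw [pos_iff_ne_zero, wordWeight, ne_eq, List.prod_eq_zero_iff]
  simpa using fun i _ => (hr i).ne'

theorem dist_wordComp (hg : ∀ i x y, dist (g i x) (g i y) = r i * dist x y) (w : List ι)
    (x y : X) : dist (wordComp g w x) (wordComp g w y) = wordWeight r w * dist x y := by
  induction w with
  | nil => simp [wordComp, wordWeight]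
  | cons i w ih => simp [wordComp, wordWeight, hg, ih, mul_assoc]

theorem lipschitzWith_wordComp (hg : ∀ i x y, dist (g i x) (g i y) = r i * dist x y)
    (w : List ι) : LipschitzWith (wordWeight r w) (wordComp g w) :=
  LipschitzWith.of_dist_le_mul fun x y => (dist_wordComp hg w x y).le

theorem injective_of_dist_eq (hr : ∀ i, 0 < r i)
    (hg : ∀ i x y, dist (g i x) (g i y) = r i * dist x y) (i : ι) : Injective (g i) := by
  intro x y hxy
  have h := hg i x y
  rw [hxy, dist_self, zero_eq_mul] at h
  exact dist_eq_zero.1 (h.resolve_left (by exact_mod_cast (hr i).ne'))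

theorem exists_ratio_bound [Finite ι] [Nonempty ι] (hr1 : ∀ i, r i < 1) :
    ∃ K < 1, ∀ i, r i ≤ K := by
  obtain ⟨i, hi⟩ := Finite.exists_max r
  exact ⟨r i, hr1 i, hi⟩

/-- The pieces of the attractor at level `N` have diameters `≤ r_v · diam A`, and the sum of the
`s`-th powers of the `r_v` over all words of length `N` is `1`. -/
theorem hausdorffMeasure_attractor_le [Fintype ι] [Nonempty ι] [MeasurableSpace X] [BorelSpace X]
    (hr1 : ∀ i, r i < 1) (hg : ∀ i x y, dist (g i x) (g i y) = r i * dist x y)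
    {A : Set X} (hA : IsAttractor g A) {s : ℝ} (hs : 0 ≤ s) (hsum : ∑ i, r i ^ s = 1) :
    μH[s] A ≤ Metric.ediam A ^ s := by
  obtain ⟨K, hK1, hK⟩ := exists_ratio_bound hr1
  have hlip : ∀ N (v : Fin N → ι), Metric.ediam (wordComp g (List.ofFn v) '' A) ≤
      (∏ j, r (v j) : ℝ≥0) * Metric.ediam A := fun N v => by
    rw [← wordWeight_ofFn]
    exact (lipschitzWith_wordComp hg _).ediam_image_le A
  have hdiam : Metric.ediam A ≠ ∞ := hA.2.1.isBounded.ediam_ne_top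
  have hr0 : Tendsto (fun N : ℕ => (K : ℝ≥0∞) ^ N * Metric.ediam A) atTop (𝓝 0) := by
    have := ENNReal.Tendsto.mul_const
      (ENNReal.tendsto_pow_atTop_nhds_zero_of_lt_one (r := (K : ℝ≥0∞)) (by exact_mod_cast hK1))
      (b := Metric.ediam A) (Or.inr hdiam)
    simpa using this
  refine (Measure.hausdorffMeasure_le_liminf_sum (ι := fun N : ℕ => Fin N → ι) s A
    (fun N : ℕ => (K : ℝ≥0∞) ^ N * Metric.ediam A) hr0
    (fun N v => wordComp g (List.ofFn v) '' A) (Eventually.of_forall fun N v => ?_)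
    (Eventually.of_forall fun N => (eq_iUnion_wordComp hA.2.2 N).subset)).trans ?_
  · refine (hlip N v).trans ?_
    gcongr
    rw [← wordWeight_ofFn]
    exact_mod_cast (wordWeight_le_pow hK (List.ofFn v)).trans_eq (by simp)
  · refine liminf_le_of_le ?_ ?_
    · isBoundedDefault
    · intro b hb
      obtain ⟨N, hN⟩ := hb.exists
      refine hN.trans ?_
      calc ∑ v : Fin N → ι, Metric.ediam (wordComp g (List.ofFn v) '' A) ^ s
          ≤ ∑ v : Fin N → ι, ((∏ j, r (v j) ^ s : ℝ≥0) : ℝ≥0∞) * Metric.ediam A ^ s := by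
            refine Finset.sum_le_sum fun v _ => ?_
            refine (ENNReal.rpow_le_rpow (hlip N v) hs).trans_eq ?_
            rw [ENNReal.mul_rpow_of_nonneg _ _ hs, ← ENNReal.coe_rpow_of_nonneg _ hs,
              NNReal.finsetProd_rpow]
        _ = Metric.ediam A ^ s := by
            rw [← Finset.sum_mul, ← ENNReal.ofNNReal_finsetSum,
              ← Fintype.sum_pow (fun i => r i ^ s), hsum]
            simp

end Similarities

/-! ### Sequences, cylinders and the coding map -/

section Coding

variable {ι X : Type*}

/-- The word formed by the first `n` letters of the sequence `σ`. -/
def seqPrefix (σ : ℕ → ι) (n : ℕ) : List ι := (List.range n).map σ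

theorem length_seqPrefix (σ : ℕ → ι) (n : ℕ) : (seqPrefix σ n).length = n := by
  simp [seqPrefix]

theorem seqPrefix_succ (σ : ℕ → ι) (n : ℕ) :
    seqPrefix σ (n + 1) = seqPrefix σ n ++ [σ n] := by
  simp [seqPrefix, List.range_succ]

theorem seqPrefix_eq_iff {σ τ : ℕ → ι} {n : ℕ} :
    seqPrefix σ n = seqPrefix τ n ↔ ∀ i < n, σ i = τ i := by
  simp [seqPrefix, List.map_inj_left]

theorem seqPrefix_take (σ : ℕ → ι) {m n : ℕ} (h : m ≤ n) :
    (seqPrefix σ n).take m = seqPrefix σ m := by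
  rw [seqPrefix, ← List.map_take, List.take_range, min_eq_left h, seqPrefix]

/-- Sequences over a finite alphabet address the points of an attractor: the point with address `σ`
lies in the piece of the attractor belonging to each prefix of `σ`. -/
theorem exists_coding [TopologicalSpace X] [T2Space X] {g : ι → X → X}
    (hg : ∀ i, Continuous (g i)) {A : Set X} (hA : IsAttractor g A) :
    ∃ π : (ℕ → ι) → X, ∀ σ n, π σ ∈ wordComp g (seqPrefix σ n) '' A := by
  have hcomp : ∀ σ : ℕ → ι, ∀ n, IsCompact (wordComp g (seqPrefix σ n) '' A) := fun σ n =>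
    hA.2.1.image (wordComp_induction (p := Continuous) continuous_id
      (fun _ _ h₁ h₂ => h₁.comp h₂) hg _)
  have hsub : ∀ i, g i '' A ⊆ A := fun i =>
    (subset_iUnion (fun i => g i '' A) i).trans hA.2.2.symm.subset
  have hne : ∀ σ : ℕ → ι, (⋂ n, wordComp g (seqPrefix σ n) '' A).Nonempty := fun σ => by
    refine IsCompact.nonempty_iInter_of_sequence_nonempty_isCompact_isClosed _ (fun n => ?_)
      (fun n => hA.1.image _) (hcomp σ 0) (fun n => (hcomp σ n).isClosed)
    rw [seqPrefix_succ, wordComp_append, image_comp]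
    exact image_mono (hsub _)
  choose π hπ using hne
  exact ⟨π, fun σ n => mem_iInter.1 (hπ σ) n⟩

theorem continuous_coding [MetricSpace X] [TopologicalSpace ι] [DiscreteTopology ι]
    {g : ι → X → X} {r : ι → ℝ≥0} {K : ℝ≥0} (hK1 : K < 1) (hK : ∀ i, r i ≤ K)
    (hg : ∀ i x y, dist (g i x) (g i y) = r i * dist x y) {A : Set X} (hA : IsCompact A)
    {π : (ℕ → ι) → X} (hπ : ∀ σ n, π σ ∈ wordComp g (seqPrefix σ n) '' A) : Continuous π := by
  rw [continuous_iff_continuousAt]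
  intro σ
  rw [ContinuousAt, Metric.tendsto_nhds]
  intro ε hε
  have hlim : Tendsto (fun n : ℕ => (K : ℝ) ^ n * Metric.diam A) atTop (𝓝 0) := by
    simpa using (tendsto_pow_atTop_nhds_zero_of_lt_one K.2
      (by exact_mod_cast hK1 : (K : ℝ) < 1)).mul_const (Metric.diam A)
  obtain ⟨n, hn⟩ := (hlim.eventually (gt_mem_nhds hε)).exists
  filter_upwards [(PiNat.isOpen_cylinder (fun _ => ι) σ n).mem_nhds
    (PiNat.self_mem_cylinder σ n)] with τ hτ
  obtain ⟨x, hx, hx'⟩ := hπ σ n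
  obtain ⟨y, hy, hy'⟩ := hπ τ n
  rw [seqPrefix_eq_iff.2 (PiNat.mem_cylinder_iff.1 hτ)] at hy'
  rw [← hx', ← hy', dist_wordComp hg]
  refine lt_of_le_of_lt ?_ hn
  have h := wordWeight_le_pow hK (seqPrefix σ n)
  rw [length_seqPrefix] at h
  gcongr
  · exact_mod_cast h
  · exact Metric.dist_le_diam_of_mem hA.isBounded hy hx

/-- The measure of the cylinder of sequences starting with `w`, for the Bernoulli measure. -/
theorem infinitePi_cylinder_word [MeasurableSpace ι] [MeasurableSingletonClass ι]
    (P : Measure ι) [IsProbabilityMeasure P] (w : List ι) :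
    Measure.infinitePi (fun _ : ℕ => P) {σ | seqPrefix σ w.length = w} =
      (w.map fun i => P {i}).prod := by
  rcases w with _ | ⟨a, w⟩
  · simp [seqPrefix]
  · have key : {σ : ℕ → ι | seqPrefix σ (a :: w).length = a :: w} =
        Set.pi (Finset.range (a :: w).length : Set ℕ) (fun i => {((a :: w)[i]?).getD a}) := by
      ext σ
      simp only [mem_ofPred_eq, Set.mem_pi, Finset.mem_coe, Finset.mem_range, mem_singleton_iff]
      rw [List.ext_getElem_iff]
      simp only [length_seqPrefix, true_and]
      constructor
      · intro h i hi
        have := h i hi hi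
        simp only [seqPrefix, List.getElem_map, List.getElem_range] at this
        rw [this, List.getElem?_eq_getElem hi, Option.getD_some]
      · intro h i hi _
        have := h i hi
        rw [List.getElem?_eq_getElem hi, Option.getD_some] at this
        simp only [seqPrefix, List.getElem_map, List.getElem_range, this]
    rw [key, Measure.infinitePi_pi _ (fun i _ => measurableSet_singleton _),
      Finset.prod_range]
    conv_rhs => rw [← List.ofFn_getElem (xs := a :: w), List.map_ofFn, List.prod_ofFn]
    refine Finset.prod_congr rfl fun i _ => ?_
    simp [List.getElem?_eq_getElem i.2]

end Coding

/-! ### Cut sets -/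

section Cut

variable {ι : Type*} {r : ι → ℝ≥0}

/-- `w` is the shortest prefix of `σ` of weight at most `ρ`. -/
def IsStoppingPrefix (r : ι → ℝ≥0) (ρ : ℝ≥0) (σ : ℕ → ι) (w : List ι) : Prop :=
  seqPrefix σ w.length = w ∧ wordWeight r w ≤ ρ ∧ ∀ n < w.length, ρ < wordWeight r (seqPrefix σ n)

theorem exists_isStoppingPrefix {K : ℝ≥0} (hK1 : K < 1) (hK : ∀ i, r i ≤ K) {ρ : ℝ≥0}
    (hρ : 0 < ρ) (σ : ℕ → ι) : ∃ w, IsStoppingPrefix r ρ σ w := by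
  classical
  have hex : ∃ n, wordWeight r (seqPrefix σ n) ≤ ρ := by
    obtain ⟨n, hn⟩ := exists_pow_lt_of_lt_one hρ hK1
    exact ⟨n, ((wordWeight_le_pow hK _).trans_eq (by rw [length_seqPrefix])).trans hn.le⟩
  refine ⟨seqPrefix σ (Nat.find hex), by rw [length_seqPrefix], Nat.find_spec hex, ?_⟩
  intro n hn
  rw [length_seqPrefix] at hn
  exact not_le.1 (Nat.find_min hex hn)

theorem IsStoppingPrefix.eq_of_prefix {ρ : ℝ≥0} {σ τ : ℕ → ι} {u v : List ι}
    (hu : IsStoppingPrefix r ρ σ u) (hv : IsStoppingPrefix r ρ τ v) (huv : u <+: v) : u = v := by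
  have hlen : v.length ≤ u.length := by
    by_contra! h
    refine (hv.2.2 _ h).not_ge ?_
    rw [← seqPrefix_take τ h.le, hv.1, ← List.prefix_iff_eq_take.1 huv]
    exact hu.2.1
  exact huv.eq_of_length_le hlen

theorem IsStoppingPrefix.mul_le_wordWeight {a ρ : ℝ≥0} (ha : ∀ i, a ≤ r i) (hρ : ρ < 1)
    {σ : ℕ → ι} {w : List ι} (hw : IsStoppingPrefix r ρ σ w) : a * ρ ≤ wordWeight r w := by
  obtain ⟨h1, h2, h3⟩ := hw
  rcases hn : w.length with _ | n
  · rw [List.length_eq_zero_iff.1 hn] at h2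
    simp only [wordWeight, List.map_nil, List.prod_nil] at h2
    exact absurd h2 hρ.not_ge
  · rw [← h1, hn, seqPrefix_succ, wordWeight_append, mul_comm]
    have : wordWeight r [σ n] = r (σ n) := by simp [wordWeight]
    rw [this]
    exact mul_le_mul' (h3 n (by omega)).le (ha _)

end Cut

/-! ### The mass distribution principle -/

/-- If balls of small radius `ρ` have measure at most `C ρ ^ s`, then the measure is bounded by
`C` times the `s`-dimensional Hausdorff measure. -/
theorem le_smul_hausdorffMeasure_of_closedBall_le {X : Type*} [MetricSpace X] [MeasurableSpace X]
    [BorelSpace X] {μ : Measure X} {s : ℝ} {C : ℝ≥0} (hC : C ≠ 0)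
    (h : ∀ x, ∀ ρ : ℝ≥0, 0 < ρ → ρ < 1 → μ (Metric.closedBall x ρ) ≤ C * (ρ : ℝ≥0∞) ^ s) :
    (C : ℝ≥0∞)⁻¹ • μ ≤ μH[s] := by
  have hC' : (C : ℝ≥0∞) ≠ 0 := by exact_mod_cast hC
  have hle : ∀ S : Set X, Metric.ediam S ≤ 2⁻¹ → μ S ≤ C * Metric.ediam S ^ s := by
    intro S hS
    rcases S.eq_empty_or_nonempty with rfl | ⟨x, hx⟩
    · simp
    have hlt : Metric.ediam S < 1 := hS.trans_lt (ENNReal.inv_lt_one.2 ENNReal.one_lt_two)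
    obtain ⟨d, hd⟩ := WithTop.ne_top_iff_exists.1 (hlt.trans ENNReal.one_lt_top).ne
    change (d : ℝ≥0∞) = _ at hd
    rw [← hd] at hlt ⊢
    have hd1 : d < 1 := by exact_mod_cast hlt
    have hsub : ∀ ρ : ℝ≥0, d ≤ ρ → S ⊆ Metric.closedBall x ρ := fun ρ hρ y hy => by
      rw [Metric.mem_closedBall, ← coe_nndist, NNReal.coe_le_coe]
      refine le_trans ?_ hρ
      have := Metric.edist_le_ediam_of_mem hy hx
      rw [← hd, edist_nndist] at this
      exact_mod_cast this
    -- letting the radius decrease to `d` covers the case `d = 0` as well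
    have hlim : Tendsto (fun ρ : ℝ≥0 => (C : ℝ≥0∞) * (ρ : ℝ≥0∞) ^ s) (𝓝[>] d)
        (𝓝 (C * (d : ℝ≥0∞) ^ s)) := by
      refine ENNReal.Tendsto.const_mul ?_ (Or.inr ENNReal.coe_ne_top)
      exact ((ENNReal.continuous_rpow_const.comp ENNReal.continuous_coe).tendsto d).mono_left
        nhdsWithin_le_nhds
    have hne : (𝓝[>] d).NeBot := nhdsGT_neBot_of_exists_gt ⟨1, hd1⟩
    refine ge_of_tendsto hlim ?_
    filter_upwards [Ioo_mem_nhdsGT hd1] with ρ hρ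
    exact (measure_mono (hsub ρ hρ.1.le)).trans (h x ρ (bot_le.trans_lt hρ.1) hρ.2)
  refine Measure.le_hausdorffMeasure s _ 2⁻¹ (by simp) fun S hS => ?_
  rw [Measure.smul_apply, smul_eq_mul, ENNReal.inv_mul_le_iff hC' ENNReal.coe_ne_top]
  exact hle S hS

/-! ### The lower bound -/

theorem ball_subset_wordComp_image {ι X : Type*} [MetricSpace X] {g : ι → X → X}
    {r : ι → ℝ≥0} (hg : ∀ i x y, dist (g i x) (g i y) = r i * dist x y) (hsurj : ∀ i, Surjective (g i))
    {U : Set X} {x₀ : X} {a : ℝ} (hball : Metric.ball x₀ a ⊆ U) (w : List ι) :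
    Metric.ball (wordComp g w x₀) (wordWeight r w * a) ⊆ wordComp g w '' U := by
  intro y hy
  obtain ⟨z, rfl⟩ := wordComp_induction (p := Surjective) surjective_id
    (fun _ _ h₁ h₂ => h₁.comp h₂) hsurj w y
  refine mem_image_of_mem _ (hball ?_)
  rw [Metric.mem_ball, dist_wordComp hg] at hy
  exact lt_of_mul_lt_mul_left hy (NNReal.coe_nonneg _)

section LowerBound

variable {ι E : Type*} [NormedAddCommGroup E] [NormedSpace ℝ E] {g : ι → E → E} {r : ι → ℝ≥0}

/-- Under the open set condition a ball of radius `ρ` meets a bounded number of the pieces of the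
attractor that have size comparable to `ρ` and belong to pairwise incomparable words: the images of
a fixed point of the open set, rescaled by `ρ⁻¹`, form a uniformly separated subset of a fixed
compact ball. -/
theorem exists_ncard_le [ProperSpace E] (hr : ∀ i, 0 < r i)
    (hg : ∀ i x y, dist (g i x) (g i y) = r i * dist x y) (hsurj : ∀ i, Surjective (g i))
    (hOSC : OpenSetCondition g) {A : Set E} (hA : IsCompact A) {b : ℝ≥0} (hb : 0 < b) :
    ∃ M : ℕ, ∀ ρ : ℝ≥0, 0 < ρ → ∀ x : E, ∀ T : Set (List ι),
      (∀ w ∈ T, b * ρ ≤ wordWeight r w ∧ wordWeight r w ≤ ρ) →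
      (∀ u ∈ T, ∀ v ∈ T, u <+: v → u = v) →
      (∀ w ∈ T, (wordComp g w '' A ∩ Metric.closedBall x ρ).Nonempty) →
      T.Finite ∧ T.ncard ≤ M := by
  obtain ⟨U, ⟨x₀, hx₀⟩, hUo, hUsub, hUdisj⟩ := hOSC
  obtain ⟨a, ha, hball⟩ := Metric.isOpen_iff.1 hUo x₀ hx₀
  obtain ⟨D, hD⟩ := hA.isBounded.subset_closedBall x₀
  have hε : 0 < (b : ℝ) * a / 2 := by have : (0 : ℝ) < b := hb; positivity
  obtain ⟨t, -, htfin, htcov⟩ := finite_cover_balls_of_compact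
    (isCompact_closedBall (0 : E) (1 + max D 0)) hε
  refine ⟨t.ncard, fun ρ hρ x T hT hpre hmeet => ?_⟩
  have hρ' : (0 : ℝ) < ρ := hρ
  set y : List ι → E := fun w => (ρ : ℝ)⁻¹ • (wordComp g w x₀ - x) with hy
  have hmem : ∀ w ∈ T, ∃ z ∈ t, dist (y w) z < b * a / 2 := by
    intro w hw
    suffices h : y w ∈ Metric.closedBall (0 : E) (1 + max D 0) by
      simpa using htcov h
    obtain ⟨_, ⟨p, hp, rfl⟩, hpx⟩ := hmeet w hw
    rw [mem_closedBall_zero_iff, hy, norm_smul, norm_inv, Real.norm_of_nonneg hρ'.le,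
      inv_mul_le_iff₀ hρ', ← dist_eq_norm]
    have h1 : dist (wordComp g w x₀) (wordComp g w p) ≤ ρ * max D 0 := by
      rw [dist_wordComp hg]
      have h2 : dist x₀ p ≤ max D 0 := by
        rw [dist_comm]; exact (hD hp).trans (le_max_left _ _)
      have h3 : (wordWeight r w : ℝ) ≤ ρ := (hT w hw).2
      gcongr
    linarith [dist_triangle (wordComp g w x₀) (wordComp g w p) x, Metric.mem_closedBall.1 hpx]
  choose! F hFt hF using hmem
  have hinj : InjOn F T := by
    intro u hu v hv huv
    by_contra hne
    have hdisj := disjoint_wordComp_image (injective_of_dist_eq hr hg) hUsub hUdisj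
      (fun h => hne (hpre u hu v hv h)) (fun h => hne (hpre v hv u hu h).symm)
    have hfar : (wordWeight r u : ℝ) * a ≤ dist (wordComp g v x₀) (wordComp g u x₀) := by
      by_contra! hlt
      exact disjoint_left.1 hdisj (ball_subset_wordComp_image hg hsurj hball u hlt)
        (mem_image_of_mem _ hx₀)
    have hw : (b : ℝ) * ρ ≤ wordWeight r u := (hT u hu).1
    have hclose : dist (y v) (y u) < b * a := by
      have h1 := hF u hu
      have h2 := hF v hv
      rw [huv] at h1
      rw [dist_comm] at h1
      linarith [dist_triangle (y v) (F v) (y u)]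
    rw [hy, dist_smul₀, norm_inv, Real.norm_of_nonneg hρ'.le, dist_sub_right,
      inv_mul_lt_iff₀ hρ'] at hclose
    nlinarith [mul_le_mul_of_nonneg_right hw ha.le]
  exact ⟨Set.Finite.of_injOn hFt hinj htfin, ncard_le_ncard_of_injOn F hFt hinj htfin⟩

/-- The image under the coding map of the Bernoulli measure with weights `r i ^ s` satisfies the
hypothesis of the mass distribution principle, because the cylinder of a word `w` has measure
`(wordWeight r w) ^ s`. -/
theorem hausdorffMeasure_attractor_ne_zero [Fintype ι] [Nonempty ι] [ProperSpace E]
    [MeasurableSpace E] [BorelSpace E] (hr : ∀ i, 0 < r i) (hr1 : ∀ i, r i < 1)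
    (hg : ∀ i x y, dist (g i x) (g i y) = r i * dist x y) (hsurj : ∀ i, Surjective (g i))
    (hOSC : OpenSetCondition g) {A : Set E} (hA : IsAttractor g A) {s : ℝ} (hs : 0 ≤ s)
    (hsum : ∑ i, r i ^ s = 1) : μH[s] A ≠ 0 := by
  obtain ⟨K, hK1, hK⟩ := exists_ratio_bound hr1
  obtain ⟨i₀, hb⟩ := Finite.exists_min r
  obtain ⟨M, hM⟩ := exists_ncard_le hr hg hsurj hOSC hA.2.1 (hr i₀)
  let _ : TopologicalSpace ι := ⊥
  have : DiscreteTopology ι := ⟨rfl⟩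
  let _ : MeasurableSpace ι := ⊤
  have : BorelSpace ι := ⟨borel_eq_top_of_discrete.symm⟩
  let P : PMF ι := PMF.ofFintype (fun i => ((r i ^ s : ℝ≥0) : ℝ≥0∞)) (by exact_mod_cast hsum)
  let ν : Measure (ℕ → ι) := Measure.infinitePi fun _ => P.toMeasure
  have hν : ∀ w : List ι, ν {σ | seqPrefix σ w.length = w} = (wordWeight r w : ℝ≥0∞) ^ s := by
    intro w
    rw [infinitePi_cylinder_word]
    induction w with
    | nil => simp [wordWeight]
    | cons i w ih =>
      rw [List.map_cons, List.prod_cons, ih, P.toMeasure_apply_singleton _ (by measurability)]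
      simp only [wordWeight, List.map_cons, List.prod_cons, ENNReal.coe_mul,
        ENNReal.mul_rpow_of_nonneg _ _ hs]
      rw [PMF.ofFintype_apply, ENNReal.coe_rpow_of_nonneg _ hs]
  obtain ⟨π, hπ⟩ := exists_coding (fun i => (LipschitzWith.of_dist_le_mul
    fun x y => (hg i x y).le).continuous) hA
  have hπm : Measurable π := (continuous_coding hK1 hK hg hA.2.1 hπ).measurable
  have hballs : ∀ x, ∀ ρ : ℝ≥0, 0 < ρ → ρ < 1 →
      ν.map π (Metric.closedBall x ρ) ≤ ((M + 1 : ℕ) : ℝ≥0) * (ρ : ℝ≥0∞) ^ s := by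
    intro x ρ hρ hρ1
    rw [Measure.map_apply hπm Metric.isClosed_closedBall.measurableSet]
    set T : Set (List ι) := {w | ∃ σ, IsStoppingPrefix r ρ σ w ∧ π σ ∈ Metric.closedBall x ρ}
    obtain ⟨hTfin, hTcard⟩ := hM ρ hρ x T
      (by rintro w ⟨σ, hσ, -⟩; exact ⟨hσ.mul_le_wordWeight hb hρ1, hσ.2.1⟩)
      (by rintro u ⟨σ, hσ, -⟩ v ⟨τ, hτ, -⟩ huv; exact hσ.eq_of_prefix hτ huv)
      (by
        rintro w ⟨σ, hσ, hx⟩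
        have := hπ σ w.length
        rw [hσ.1] at this
        exact ⟨π σ, this, hx⟩)
    have hcov : π ⁻¹' Metric.closedBall x ρ ⊆
        ⋃ w ∈ hTfin.toFinset, {σ | seqPrefix σ w.length = w} := by
      intro σ hσ
      obtain ⟨w, hw⟩ := exists_isStoppingPrefix hK1 hK hρ σ
      exact mem_biUnion (hTfin.mem_toFinset.2 ⟨σ, hw, hσ⟩) hw.1
    calc ν (π ⁻¹' Metric.closedBall x ρ)
        ≤ ∑ w ∈ hTfin.toFinset, ν {σ | seqPrefix σ w.length = w} :=
          (measure_mono hcov).trans (measure_biUnion_finset_le _ _)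
      _ ≤ ∑ w ∈ hTfin.toFinset, (ρ : ℝ≥0∞) ^ s := by
          refine Finset.sum_le_sum fun w hw => ?_
          obtain ⟨σ, hσ, -⟩ := hTfin.mem_toFinset.1 hw
          rw [hν]
          exact ENNReal.rpow_le_rpow (by exact_mod_cast hσ.2.1) hs
      _ ≤ ((M + 1 : ℕ) : ℝ≥0) * (ρ : ℝ≥0∞) ^ s := by
          rw [Finset.sum_const, nsmul_eq_mul, ← ncard_eq_toFinset_card T hTfin]
          gcongr
          exact_mod_cast hTcard.trans (Nat.le_succ M)
  have hle := le_smul_hausdorffMeasure_of_closedBall_le (by positivity) hballs A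
  have hone : ν.map π A = 1 := by
    rw [Measure.map_apply hπm hA.2.1.isClosed.measurableSet]
    have : π ⁻¹' A = univ := eq_univ_of_forall fun σ => by
      simpa [seqPrefix, wordComp] using hπ σ 0
    rw [this, measure_univ]
  intro h0
  rw [h0, Measure.smul_apply, hone] at hle
  simp at hle

/-- **Moran's formula** for similarities satisfying the open set condition. -/
theorem dimH_attractor [Fintype ι] [Nonempty ι] [ProperSpace E]
    (hr : ∀ i, 0 < r i) (hr1 : ∀ i, r i < 1)
    (hg : ∀ i x y, dist (g i x) (g i y) = r i * dist x y) (hsurj : ∀ i, Surjective (g i))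
    (hOSC : OpenSetCondition g) {A : Set E} (hA : IsAttractor g A) {s : ℝ≥0}
    (hsum : ∑ i, r i ^ (s : ℝ) = 1) : dimH A = s := by
  borelize E
  refine le_antisymm (dimH_le_of_hausdorffMeasure_ne_top ?_) ?_
  · refine ((hausdorffMeasure_attractor_le hr1 hg hA s.2 hsum).trans_lt ?_).ne
    exact ENNReal.rpow_lt_top_of_nonneg s.2 hA.2.1.isBounded.ediam_ne_top
  · exact le_dimH_of_hausdorffMeasure_ne_zero
      (hausdorffMeasure_attractor_ne_zero hr hr1 hg hsurj hOSC hA s.2 hsum)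

end LowerBound

/-! ### Ratios of compositions of affine maps -/

section Affine

variable {m n k : ℕ}

theorem abs_det_eq_pow_of_norm_eq {L : EuclideanSpace ℝ (Fin m) →ₗ[ℝ] EuclideanSpace ℝ (Fin m)}
    {c : ℝ} (hc : 0 < c) (h : ∀ x, ‖L x‖ = c * ‖x‖) : |LinearMap.det L| = c ^ m := by
  let I : EuclideanSpace ℝ (Fin m) →ₗᵢ[ℝ] EuclideanSpace ℝ (Fin m) :=
    ⟨c⁻¹ • L, fun x => by
      rw [LinearMap.smul_apply, norm_smul, norm_inv, Real.norm_of_nonneg hc.le, h,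
        inv_mul_cancel_left₀ hc.ne']⟩
  have h1 : (c⁻¹ • L).normDet = 1 := I.normDet_eq_one
  rw [LinearMap.normDet_eq_abs_det, LinearMap.det_smul, finrank_euclideanSpace_fin, abs_mul,
    abs_of_pos (by positivity), inv_pow, inv_mul_eq_one₀ (by positivity)] at h1
  exact h1.symm

theorem abs_det_linear_of_isSimilarityContractionWith
    {g : EuclideanSpace ℝ (Fin m) →ᵃ[ℝ] EuclideanSpace ℝ (Fin m)} {c : ℝ}
    (hg : IsSimilarityContractionWith c g) : |LinearMap.det g.linear| = c ^ m := by
  refine abs_det_eq_pow_of_norm_eq hg.1 fun x => ?_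
  have h := hg.2.2 x 0
  rwa [← vsub_eq_sub, ← g.linearMap_vsub, vsub_eq_sub, sub_zero] at h

theorem wordComp_affine (f : Fin n → EuclideanSpace ℝ (Fin m) →ᵃ[ℝ] EuclideanSpace ℝ (Fin m))
    (w : List (Fin n)) : wordComp (fun i => ⇑(f i)) w = ⇑((w.map f).prod) := by
  induction w with
  | nil => rfl
  | cons i w ih => rw [wordComp, ih, List.map_cons, List.prod_cons, AffineMap.coe_mul]

theorem abs_det_linear_list_prod
    (f : Fin n → EuclideanSpace ℝ (Fin m) →ᵃ[ℝ] EuclideanSpace ℝ (Fin m)) (w : List (Fin n)) :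
    |LinearMap.det ((w.map f).prod).linear| =
      (w.map fun i => |LinearMap.det (f i).linear|).prod := by
  induction w with
  | nil =>
    have h : (1 : EuclideanSpace ℝ (Fin m) →ᵃ[ℝ] EuclideanSpace ℝ (Fin m)).linear =
      LinearMap.id := rfl
    simp [h]
  | cons i w ih =>
    rw [List.map_cons, List.prod_cons, List.map_cons, List.prod_cons, ← ih, ← abs_mul,
      ← LinearMap.det_comp]
    rfl

/-- The ratio of a composition of length `k` is the product of the `k`-th roots of the ratios
`C i` of the iterates `f i^[k]`: determinants are multiplicative, and the `m`-th power of the ratio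
of a similarity is the absolute value of its determinant. -/
theorem isSimilarityContractionWith_wordWeight (hk : 1 ≤ k)
    {f : Fin n → EuclideanSpace ℝ (Fin m) →ᵃ[ℝ] EuclideanSpace ℝ (Fin m)} {C : Fin n → ℝ≥0}
    (hC : ∀ i, IsSimilarityContractionWith (C i : ℝ) ((⇑(f i))^[k])) {w : List (Fin n)}
    (hw : w.length = k) (hsim : IsSimilarityContraction (wordComp (fun i => ⇑(f i)) w)) :
    IsSimilarityContractionWith (wordWeight (fun i => C i ^ (k : ℝ)⁻¹) w : ℝ)
      (wordComp (fun i => ⇑(f i)) w) := by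
  have hk0 : k ≠ 0 := by omega
  have hC0 : ∀ i, 0 < C i := fun i => by exact_mod_cast (hC i).1
  have hC1 : ∀ i, C i < 1 := fun i => by exact_mod_cast (hC i).2.1
  rcases Nat.eq_zero_or_pos m with rfl | hm
  · -- in dimension `0` every number in `(0, 1)` is a ratio
    have : Nonempty (Fin n) := ⟨w.get ⟨0, by omega⟩⟩
    obtain ⟨K, hK1, hK⟩ := exists_ratio_bound (r := fun i => C i ^ (k : ℝ)⁻¹)
      (fun i => NNReal.rpow_lt_one (hC1 i) (by positivity))
    refine ⟨?_, ?_, fun x y => ?_⟩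
    · exact_mod_cast wordWeight_pos (fun i => NNReal.rpow_pos (hC0 i)) w
    · exact_mod_cast (wordWeight_le_pow hK w).trans_lt (pow_lt_one₀ bot_le hK1 (by omega))
    · simp [Subsingleton.elim x y]
  · obtain ⟨d, hd⟩ := hsim
    suffices h : d = (wordWeight (fun i => C i ^ (k : ℝ)⁻¹) w : ℝ) from h ▸ hd
    have hletter : ∀ i, |LinearMap.det (f i).linear| = ((C i ^ (k : ℝ)⁻¹ : ℝ≥0) : ℝ) ^ m := by
      intro i
      have h := hC i
      rw [← wordComp_replicate (fun i => ⇑(f i)) i k, wordComp_affine] at h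
      have h1 := abs_det_linear_of_isSimilarityContractionWith h
      rw [abs_det_linear_list_prod, List.map_replicate, List.prod_replicate] at h1
      refine (pow_left_inj₀ (abs_nonneg _) (by positivity) hk0).1 ?_
      rw [h1, ← pow_mul, mul_comm m k, pow_mul, ← NNReal.coe_pow (C i ^ (k : ℝ)⁻¹),
        NNReal.rpow_inv_natCast_pow _ hk0]
    rw [wordComp_affine] at hd
    have h1 := abs_det_linear_of_isSimilarityContractionWith hd
    rw [abs_det_linear_list_prod] at h1
    refine (pow_left_inj₀ hd.1.le (NNReal.coe_nonneg _) hm.ne').1 ?_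
    rw [← h1]
    simp only [hletter, wordWeight]
    clear * -
    induction w with
    | nil => simp
    | cons i w ih => simp only [List.map_cons, List.prod_cons, ih, NNReal.coe_mul, mul_pow]

theorem injective_of_isSimilarityContractionWith_iterate (hk : 1 ≤ k)
    {g : EuclideanSpace ℝ (Fin m) → EuclideanSpace ℝ (Fin m)} {c : ℝ}
    (hg : IsSimilarityContractionWith c g^[k]) : Injective g := by
  obtain ⟨k, rfl⟩ := Nat.exists_eq_add_of_le' hk
  intro x y hxy
  have h := hg.2.2 x y
  rw [iterate_succ_apply, iterate_succ_apply, hxy, sub_self, norm_zero, zero_eq_mul] at h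
  exact sub_eq_zero.1 (norm_eq_zero.1 (h.resolve_left hg.1.ne'))

theorem AffineMap.surjective_of_injective_of_finiteDimensional
    {g : EuclideanSpace ℝ (Fin m) →ᵃ[ℝ] EuclideanSpace ℝ (Fin m)} (hg : Injective g) :
    Surjective g :=
  g.linear_surjective_iff.1 (LinearMap.injective_iff_surjective.1 (g.linear_injective_iff.2 hg))

end Affine

/-! ### The dimension equation -/

theorem exists_unique_sum_rpow_eq_one {ι : Type*} [Fintype ι] [Nonempty ι] {c : ι → ℝ}
    (hc0 : ∀ i, 0 < c i) (hc1 : ∀ i, c i < 1) :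
    ∃ t : ℝ, 0 ≤ t ∧ ∑ i, c i ^ t = 1 ∧ ∀ u : ℝ, ∑ i, c i ^ u = 1 → u = t := by
  have hanti : StrictAnti fun t : ℝ => ∑ i, c i ^ t := fun a b hab =>
    Finset.sum_lt_sum_of_nonempty Finset.univ_nonempty fun i _ =>
      Real.rpow_lt_rpow_of_exponent_gt (hc0 i) (hc1 i) hab
  have hcont : Continuous fun t : ℝ => ∑ i, c i ^ t :=
    continuous_finsetSum _ fun i _ => Real.continuous_const_rpow (hc0 i).ne'
  have hlim : Tendsto (fun t : ℝ => ∑ i, c i ^ t) atTop (𝓝 0) := by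
    simpa using tendsto_finsetSum Finset.univ fun i _ =>
      tendsto_rpow_atTop_of_base_lt_one (c i) (by linarith [hc0 i]) (hc1 i)
  obtain ⟨T, hT1, hT0⟩ :=
    ((hlim.eventually (gt_mem_nhds one_pos)).and (eventually_ge_atTop 0)).exists
  have h0 : 1 ≤ ∑ i, c i ^ (0 : ℝ) := by
    simpa using (Nat.one_le_cast (α := ℝ)).2 (Fintype.card_pos (α := ι))
  obtain ⟨t, ht, hft⟩ := intermediate_value_Icc' hT0 hcont.continuousOn ⟨hT1.le, h0⟩
  exact ⟨t, ht.1, hft, fun u hu => hanti.injective (hu.trans hft.symm)⟩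

/-! ### Systems whose compositions of a fixed length are similarity contractions -/

theorem OpenSetCondition.wordComp_ofFn {ι X : Type*} [TopologicalSpace X] {f : ι → X → X}
    (hinj : ∀ i, Injective (f i)) (h : OpenSetCondition f) (k : ℕ) :
    OpenSetCondition fun v : Fin k → ι => wordComp f (List.ofFn v) := by
  obtain ⟨U, hne, hU, hsub, hdisj⟩ := h
  refine ⟨U, hne, hU, iUnion_subset fun v => wordComp_image_subset hsub _, fun u v huv => ?_⟩
  rw [← disjoint_iff_inter_eq_empty]
  have hlen : (List.ofFn u).length = (List.ofFn v).length := by simp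
  exact disjoint_wordComp_image hinj hsub hdisj
    (fun h => huv (List.ofFn_injective (h.eq_of_length hlen)))
    (fun h => huv (List.ofFn_injective (h.eq_of_length hlen.symm)).symm)

theorem mainTheorem3 (m n k : ℕ) (hn : 1 ≤ n) (hk : 1 ≤ k)
    (f : Fin n → EuclideanSpace ℝ (Fin m) →ᵃ[ℝ] EuclideanSpace ℝ (Fin m))
    (hOSC : OpenSetCondition (fun i => ⇑(f i)))
    (hsim : ∀ w : List (Fin n), w.length = k →
      IsSimilarityContraction (wordComp (fun i => ⇑(f i)) w))
    (c : Fin n → ℝ)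
    (hc : ∀ i, IsSimilarityContractionWith (c i) ((⇑(f i))^[k])) :
    ∃ A : Set (EuclideanSpace ℝ (Fin m)),
      IsAttractor (fun i => ⇑(f i)) A ∧
      (∀ B : Set (EuclideanSpace ℝ (Fin m)), IsAttractor (fun i => ⇑(f i)) B → B = A) ∧
      ∃ s : ℝ, 0 ≤ s ∧ dimH A = ENNReal.ofReal s ∧
        ∑ i, c i ^ (s / (k : ℝ)) = 1 ∧
        ∀ t : ℝ, ∑ i, c i ^ (t / (k : ℝ)) = 1 → t = s := by
  have : Nonempty (Fin n) := ⟨⟨0, hn⟩⟩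
  have hk' : (0 : ℝ) < k := by exact_mod_cast hk
  lift c to Fin n → ℝ≥0 using fun i => (hc i).1.le
  have hinj : ∀ i, Injective (f i) := fun i =>
    injective_of_isSimilarityContractionWith_iterate hk (hc i)
  -- the system `g` of all compositions of length `k`, with ratios `r`
  set g : (Fin k → Fin n) → EuclideanSpace ℝ (Fin m) → EuclideanSpace ℝ (Fin m) :=
    fun v => wordComp (fun i => ⇑(f i)) (List.ofFn v) with hg_def
  set r : (Fin k → Fin n) → ℝ≥0 := fun v => ∏ j, c (v j) ^ (k : ℝ)⁻¹ with hr_def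
  have hgr : ∀ v, IsSimilarityContractionWith (r v : ℝ) (g v) := fun v => by
    have := isSimilarityContractionWith_wordWeight hk hc (List.length_ofFn (f := v))
      (hsim _ List.length_ofFn)
    rwa [wordWeight_ofFn] at this
  have hr0 : ∀ v, 0 < r v := fun v => by exact_mod_cast (hgr v).1
  have hr1 : ∀ v, r v < 1 := fun v => by exact_mod_cast (hgr v).2.1
  have hdist : ∀ v x y, dist (g v x) (g v y) = r v * dist x y := fun v x y => by
    simpa only [dist_eq_norm] using (hgr v).2.2 x y
  obtain ⟨K, hK1, hK⟩ := exists_ratio_bound hr1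
  obtain ⟨A, hA, hAuniq⟩ := exists_unique_isAttractor
    (fun i => (f i).continuous_of_finiteDimensional) hK1 (N := k) fun v =>
      (LipschitzWith.of_dist_le_mul fun x y => (hdist v x y).le).weaken (hK v)
  have hAg : IsAttractor g A := ⟨hA.1, hA.2.1, eq_iUnion_wordComp hA.2.2 k⟩
  obtain ⟨t, ht0, ht, htuniq⟩ := exists_unique_sum_rpow_eq_one (fun i => (hc i).1)
    (fun i => (hc i).2.1)
  refine ⟨A, hA, hAuniq, t * k, by positivity, ?_, ?_, fun u hu => ?_⟩
  · -- summed over all words of length `k`, the dimension equation becomes its own `k`-th power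
    have hsum : ∑ v, r v ^ (t * k) = 1 := by
      have h1 : ∑ i, c i ^ t = 1 := by exact_mod_cast ht
      have h2 : ∀ i, (c i ^ (k : ℝ)⁻¹) ^ (t * k) = c i ^ t := fun i => by
        rw [← NNReal.rpow_mul]
        congr 1
        field_simp
      simp only [hr_def, ← NNReal.finsetProd_rpow, h2]
      rw [← Fintype.sum_pow (fun i => c i ^ t), h1, one_pow]
    have hsurj : ∀ v, Surjective (g v) := fun v =>
      wordComp_induction (p := Surjective) surjective_id (fun _ _ h₁ h₂ => h₁.comp h₂)
        (fun i => (f i).surjective_of_injective_of_finiteDimensional (hinj i)) _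
    exact dimH_attractor (s := ⟨t * k, by positivity⟩) hr0 hr1 hdist hsurj
      (hOSC.wordComp_ofFn hinj k) hAg hsum |>.trans (ENNReal.ofReal_eq_coe_nnreal _).symm
  · rwa [mul_div_cancel_right₀ _ hk'.ne']
  · rw [← htuniq _ hu, div_mul_cancel₀ _ hk'.ne']
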